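/- There exist a sequence $(V_n,E_n)_{n\in\mathbb N}$ of expanders and, for each $n$, a finite measure $m_n$ on $V_n$ of full support (that is, $m_n(\{v\})>0$ for every $v\in V_n$), such that the sequence of finite measured graphs $(V_n,E_n,m_n)_{n\in\mathbb N}$ is ghostly but is not a sequence of measured expanders. Here all graphs are finite, connected and undirected, and $d$ is the edge-path metric. For a set $A$ of vertices, the vertex boundary is $\partial A=\{v : d(v,A)=1\}$. The Cheeger constants are $$\mathrm{ch}(V,E)=\min\Big\{\frac{|\partial A|}{|A|} : A\subseteq V,\ 0<|A|\le \tfrac12|V|\Big\},\qquad \mathrm{ch}(V,E,m)=\min\Big\{\frac{m(\partial A)}{m(A)} : A\subseteq V,\ 0<m(A)\le \tfrac12 m(V)\Big\},$$ where $m$ is a non-zero finite measure on the $\sigma$-algebra of all subsets of $V$, and a minimum over the empty set is $+\infty$. The sequence $(V_n,E_n)_n$ is a sequence of expanders if there is $K$ such that every vertex of every $(V_n,E_n)$ has at most $K$ neighbours, $|V_n|\to\infty$, and $\inf_n \mathrm{ch}(V_n,E_n)>0$. The sequence $(V_n,E_n,m_n)_n$ is a sequence of measured expanders if $\inf_n\mathrm{ch}(V_n,E_n,m_n)>0$,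 and it is ghostly if $\lim_{n\to\infty}\sup_{v\in V_n} m_n(\{v\})/m_n(V_n)=0$. -/

import Mathlib

open Filter Topology MeasureTheory
open scoped ENNReal

/-- The vertex boundary of a set `A` of vertices: all vertices at distance exactly `1` from `A`,
where the distance from `v` to `A` is the least edge-path distance from `v` to a point of `A`
(and is infinite for empty `A`). -/
def vertexBoundary {V : Type*} (G : SimpleGraph V) (A : Set V) : Set V :=
  {v | ⨅ a ∈ A, G.edist v a = 1}

theorem mem_vertexBoundary_iff {V : Type*} (G : SimpleGraph V) (A : Set V) (v : V) :
    v ∈ vertexBoundary G A ↔ v ∉ A ∧ ∃ a ∈ A, G.Adj v a := by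
  constructor
  · intro h
    have h : ⨅ a ∈ A, G.edist v a = 1 := h
    refine ⟨fun hv => ?_, ?_⟩
    · have h0 : ⨅ a ∈ A, G.edist v a ≤ G.edist v v := iInf₂_le v hv
      rw [h, SimpleGraph.edist_self] at h0
      exact absurd h0 (by simp)
    · by_contra hcon
      push Not at hcon
      have hv : v ∉ A := by
        intro hv
        have h0 : ⨅ a ∈ A, G.edist v a ≤ G.edist v v := iInf₂_le v hv
        rw [h, SimpleGraph.edist_self] at h0
        exact absurd h0 (by simp)
      have h2 : (2 : ℕ∞) ≤ ⨅ a ∈ A, G.edist v a := by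
        refine le_iInf₂ fun a ha => ?_
        have hne0 : G.edist v a ≠ 0 := by
          rw [Ne, SimpleGraph.edist_eq_zero_iff]
          rintro rfl
          exact hv ha
        have hne1 : G.edist v a ≠ 1 := by
          rw [Ne, SimpleGraph.edist_eq_one_iff_adj]
          exact hcon a ha
        have h1 : 1 < G.edist v a :=
          lt_of_le_of_ne (Order.one_le_iff_pos.mpr (pos_iff_ne_zero.mpr hne0)) (Ne.symm hne1)
        exact Order.add_one_le_of_lt h1
      rw [h] at h2
      exact absurd h2 (by decide)
  · rintro ⟨hv, a, ha, hadj⟩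
    change ⨅ a ∈ A, G.edist v a = 1
    refine le_antisymm ?_ ?_
    · exact (iInf₂_le a ha).trans (SimpleGraph.edist_eq_one_iff_adj.mpr hadj).le
    · refine le_iInf₂ fun b hb => ?_
      rw [Order.one_le_iff_pos, pos_iff_ne_zero, Ne, SimpleGraph.edist_eq_zero_iff]
      rintro rfl
      exact hv hb

/-- A finite connected undirected graph. -/
structure FiniteGraph where
  /-- the vertex set -/
  Vert : Type
  finite : Finite Vert
  /-- the edges -/
  graph : SimpleGraph Vert
  connected : graph.Connected

/-- The Cheeger constant of a finite graph: the minimum of `|∂A| / |A|` over all sets `A` of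
vertices with `0 < |A| ≤ |V| / 2`. It is `∞` if there is no such `A`, that is, if the graph has
only one vertex. -/
noncomputable def FiniteGraph.cheeger (X : FiniteGraph) : ℝ≥0∞ :=
  ⨅ (A : Set X.Vert) (_ : 0 < A.ncard ∧ (A.ncard : ℝ≥0∞) ≤ (Nat.card X.Vert : ℝ≥0∞) / 2),
    ((vertexBoundary X.graph A).ncard : ℝ≥0∞) / (A.ncard : ℝ≥0∞)

/-- A sequence of (classical) expanders. -/
structure IsExpanderSequence (X : ℕ → FiniteGraph) : Prop where
  uniformly_bounded_valency :
    ∃ K : ℕ, ∀ (n : ℕ) (v : (X n).Vert), ((X n).graph.neighborSet v).ncard ≤ K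
  card_tendsto : Tendsto (fun n => Nat.card (X n).Vert) atTop atTop
  cheeger_pos : 0 < ⨅ n, (X n).cheeger

/-- A finite measured graph: a finite connected graph with a non-zero finite measure on the
σ-algebra of all subsets of its vertex set. -/
structure FiniteMeasuredGraph extends FiniteGraph where
  /-- the measure -/
  measure : @Measure Vert ⊤
  measure_finite : measure Set.univ < ∞
  measure_nontrivial : measure ≠ 0

/-- The measure has full support: every vertex has positive measure. -/
def FiniteMeasuredGraph.HasFullSupport (X : FiniteMeasuredGraph) : Prop :=
  {v : X.Vert | X.measure {v} ≠ 0} = Set.univ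

/-- The Cheeger constant of a finite measured graph: the minimum of `m(∂A) / m(A)` over all sets
`A` of vertices with `0 < m(A) ≤ m(V) / 2`, and `∞` if there is no such `A`. -/
noncomputable def FiniteMeasuredGraph.measuredCheeger (X : FiniteMeasuredGraph) : ℝ≥0∞ :=
  ⨅ (A : Set X.Vert) (_ : 0 < X.measure A ∧ X.measure A ≤ X.measure Set.univ / 2),
    X.measure (vertexBoundary X.graph A) / X.measure A

/-- A sequence of measured expanders. -/
def IsMeasuredExpanderSequence (X : ℕ → FiniteMeasuredGraph) : Prop :=
  0 < ⨅ n, (X n).measuredCheeger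

/-- A ghostly sequence of finite measured graphs. -/
def IsGhostly (X : ℕ → FiniteMeasuredGraph) : Prop :=
  Tendsto (fun n => ⨆ v : (X n).Vert, (X n).measure {v} / (X n).measure Set.univ) atTop (𝓝 0)

/-! ### Fourier transform on `(ℤ/m)²` -/

/-! The measure is the easy half and works on any large graph of valency at most `K`. Pick any set
`A` of `n` vertices, give each vertex of `∂A` mass `1/n` and every other vertex mass 1. Then `A` has
mass `n` while `∂A` has mass at most `K`, so the measured Cheeger constant is at most `K/n`. The
total mass is at least `2n`, so no atom carries a large share (`exists_measure_of_valency_le`).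

What remains is one family of expanders, here the Margulis graphs on `(ℤ/m)²`, generated by two
translations and two shears. Let `f` have mean zero and be almost invariant under all four, with
Fourier transform `F`. Then `F 0 = 0`, and the translations force most of the mass of `|F|²` onto
frequencies with coordinates below `m/4`. The shears act on frequencies by inverse transposes, so
`|F|²` is almost shear-invariant. Near the origin nothing wraps around, and on `ℤ² ∖ 0` such mass
cannot exist: shears push plane sectors into themselves, and each nonzero point enters some sector
(`one_le_sectorGrowth`). Hence `f = 0` (`spectral_gap`); centred indicators of sets turn this into
the Cheeger bound. -/

theorem ZMod.parseval {m : ℕ} [NeZero m] (f : ZMod m → ℂ) :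
    ∑ p, ‖∑ x, f x * ZMod.stdAddChar (p * x)‖ ^ 2 = m * ∑ x, ‖f x‖ ^ 2 := by
  rw [← Complex.ofReal_inj]
  push_cast
  simp_rw [← Complex.mul_conj', map_sum, Finset.sum_mul_sum, map_mul, ← AddChar.map_neg_eq_conj]
  rw [Finset.sum_comm, Finset.mul_sum]
  refine Finset.sum_congr rfl fun x _ => ?_
  rw [Finset.sum_comm]
  have h : ∀ y : ZMod m, ∑ p : ZMod m, f x * ZMod.stdAddChar (p * x) *
      ((starRingEnd ℂ) (f y) * ZMod.stdAddChar (-(p * y))) =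
      if x = y then m * (f x * (starRingEnd ℂ) (f y)) else 0 := by
    intro y
    have h1 : ∀ p : ZMod m, f x * ZMod.stdAddChar (p * x) *
        ((starRingEnd ℂ) (f y) * ZMod.stdAddChar (-(p * y))) =
        f x * (starRingEnd ℂ) (f y) * ZMod.stdAddChar (p * (x - y)) := by
      intro p
      rw [mul_sub, sub_eq_add_neg, AddChar.map_add_eq_mul]
      ring
    simp_rw [h1]
    rw [← Finset.mul_sum, AddChar.sum_mulShift _ (ZMod.isPrimitive_stdAddChar m), ZMod.card]
    simp only [sub_eq_zero]
    split_ifs <;> simp [mul_comm]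
  simp_rw [h]
  simp

/-- The Fourier transform of a function on `(ℤ/m)²`. -/
noncomputable def torusFourier {m : ℕ} [NeZero m] (f : ZMod m × ZMod m → ℂ)
    (z : ZMod m × ZMod m) : ℂ :=
  ∑ w, f w * ZMod.stdAddChar (z.1 * w.1 + z.2 * w.2)

theorem torusFourier_sub {m : ℕ} [NeZero m] (f g : ZMod m × ZMod m → ℂ) (z : ZMod m × ZMod m) :
    torusFourier (fun w => f w - g w) z = torusFourier f z - torusFourier g z := by
  simp [torusFourier, sub_mul]

theorem torusFourier_parseval {m : ℕ} [NeZero m] (f : ZMod m × ZMod m → ℂ) :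
    ∑ z, ‖torusFourier f z‖ ^ 2 = (m : ℝ) ^ 2 * ∑ w, ‖f w‖ ^ 2 := by
  have h : ∀ p q : ZMod m, torusFourier f (p, q) =
      ∑ y, (∑ x, f (x, y) * ZMod.stdAddChar (p * x)) * ZMod.stdAddChar (q * y) := by
    intro p q
    rw [torusFourier, Fintype.sum_prod_type_right]
    refine Finset.sum_congr rfl fun y _ => ?_
    rw [Finset.sum_mul]
    refine Finset.sum_congr rfl fun x _ => ?_
    rw [AddChar.map_add_eq_mul, mul_assoc]
  rw [Fintype.sum_prod_type]
  simp_rw [h, ZMod.parseval]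
  rw [← Finset.mul_sum, Finset.sum_comm]
  simp_rw [ZMod.parseval]
  rw [← Finset.mul_sum, ← mul_assoc, sq, Fintype.sum_prod_type_right]

/-- The shear `(x, y) ↦ (x + y, y)`. -/
def shearLeft (m : ℕ) : ZMod m × ZMod m ≃ ZMod m × ZMod m where
  toFun z := (z.1 + z.2, z.2)
  invFun z := (z.1 - z.2, z.2)
  left_inv z := by simp
  right_inv z := by simp

/-- The shear `(x, y) ↦ (x, x + y)`. -/
def shearRight (m : ℕ) : ZMod m × ZMod m ≃ ZMod m × ZMod m where
  toFun z := (z.1, z.1 + z.2)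
  invFun z := (z.1, z.2 - z.1)
  left_inv z := by simp
  right_inv z := by simp

/-- Substituting in the sum moves a linear map to its inverse transpose on frequencies, which
exchanges the two shears and inverts them. -/
theorem torusFourier_comp_shearLeft {m : ℕ} [NeZero m] (f : ZMod m × ZMod m → ℂ)
    (z : ZMod m × ZMod m) :
    torusFourier (fun w => f (shearLeft m w)) z = torusFourier f ((shearRight m).symm z) := by
  refine Fintype.sum_equiv (shearLeft m) _ _ fun w => ?_
  congr 2
  simp only [shearLeft, shearRight, Equiv.coe_fn_mk, Equiv.coe_fn_symm_mk]
  ring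

theorem torusFourier_comp_shearRight {m : ℕ} [NeZero m] (f : ZMod m × ZMod m → ℂ)
    (z : ZMod m × ZMod m) :
    torusFourier (fun w => f (shearRight m w)) z = torusFourier f ((shearLeft m).symm z) := by
  refine Fintype.sum_equiv (shearRight m) _ _ fun w => ?_
  congr 2
  simp only [shearLeft, shearRight, Equiv.coe_fn_mk, Equiv.coe_fn_symm_mk]
  ring

theorem torusFourier_comp_add {m : ℕ} [NeZero m] (f : ZMod m × ZMod m → ℂ)
    (a z : ZMod m × ZMod m) :
    torusFourier (fun w => f (w + a)) z =
      ZMod.stdAddChar (-(z.1 * a.1 + z.2 * a.2)) * torusFourier f z := by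
  rw [torusFourier, torusFourier, Finset.mul_sum]
  refine Fintype.sum_equiv (Equiv.addRight a) _ _ fun w => ?_
  rw [mul_left_comm, ← AddChar.map_add_eq_mul]
  congr 2
  simp only [Equiv.coe_addRight, Prod.fst_add, Prod.snd_add]
  ring

/-- The angle is between `π/2` and `π` in absolute value, so the real part is nonpositive. -/
theorem one_le_norm_stdAddChar_neg_sub_one {m : ℕ} [NeZero m] {p : ZMod m}
    (hp : (m : ℤ) ≤ 4 * |p.valMinAbs|) : 1 ≤ ‖ZMod.stdAddChar (-p) - 1‖ := by
  have hm : (0 : ℝ) < m := by exact_mod_cast NeZero.pos m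
  have hre : (ZMod.stdAddChar (-p) : ℂ).re ≤ 0 := by
    have h1 : -p = ((-p.valMinAbs : ℤ) : ZMod m) := by simp
    rw [h1, ZMod.stdAddChar_coe]
    have h2 : 2 * (Real.pi : ℂ) * Complex.I * ((-p.valMinAbs : ℤ) : ℂ) / m =
        ((-(2 * Real.pi * p.valMinAbs / m) : ℝ) : ℂ) * Complex.I := by
      push_cast; ring
    rw [h2, Complex.exp_ofReal_mul_I_re, Real.cos_neg, ← Real.cos_abs]
    have hub : 2 * |p.valMinAbs| ≤ m := by
      have := ZMod.valMinAbs_mem_Ioc p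
      rw [Set.mem_Ioc] at this
      rcases abs_cases p.valMinAbs with h | h <;> omega
    have hp' : (m : ℝ) ≤ 4 * |(p.valMinAbs : ℝ)| := by exact_mod_cast hp
    have hub' : 2 * |(p.valMinAbs : ℝ)| ≤ m := by exact_mod_cast hub
    rw [abs_div, abs_mul, abs_of_pos hm, abs_of_pos Real.two_pi_pos]
    refine Real.cos_nonpos_of_pi_div_two_le_of_le ?_ ?_
    · rw [le_div_iff₀ hm]
      nlinarith [Real.pi_pos]
    · rw [div_le_iff₀ hm]
      nlinarith [Real.pi_pos]
  calc (1 : ℝ) ≤ |(ZMod.stdAddChar (-p) - 1 : ℂ).re| := by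
        rw [Complex.sub_re, Complex.one_re, abs_of_nonpos (by linarith)]
        linarith
    _ ≤ _ := Complex.abs_re_le_norm _

/-! ### Almost invariant functions -/

/-- Reindexing by `e` moves the difference from `h` onto `|F|²`. With `a = |F v|`, `b = |F (e v)|`,
`d = |F (e v) - F v|`, one has `a² - b² ≤ d(a + b)` when the left side is positive. Weighted AM-GM
splits this into `d²/ε` and `ε(a² + b²)/2`, each summing to at most `ε ∑ |F|²`. -/
theorem sum_norm_sq_mul_le_of_almost_invariant {V : Type*} [Fintype V] (F : V → ℂ) (e : V ≃ V)
    (h : V → ℝ) (h0 : ∀ v, 0 ≤ h v) (h1 : ∀ v, h v ≤ 1) {ε : ℝ} (hε : 0 < ε)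
    (hF : ∑ v, ‖F (e v) - F v‖ ^ 2 ≤ ε ^ 2 * ∑ v, ‖F v‖ ^ 2) :
    ∑ v, ‖F v‖ ^ 2 * (h (e v) - h v) ≤ 2 * ε * ∑ v, ‖F v‖ ^ 2 := by
  have hinv : ∀ g : V → ℝ, ∑ v, g (e v) = ∑ v, g v := fun g => e.sum_comp g
  have hshift : ∑ v, ‖F v‖ ^ 2 * (h (e v) - h v) =
      ∑ v, (‖F v‖ ^ 2 - ‖F (e v)‖ ^ 2) * h (e v) := by
    have := hinv fun v => ‖F v‖ ^ 2 * h v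
    simp only [mul_sub, sub_mul, Finset.sum_sub_distrib]
    linarith
  have hpt : ∀ v, (‖F v‖ ^ 2 - ‖F (e v)‖ ^ 2) * h (e v) ≤
      ‖F (e v) - F v‖ ^ 2 / ε + ε / 2 * (‖F v‖ ^ 2 + ‖F (e v)‖ ^ 2) := by
    intro v
    have ht : ‖F v‖ ≤ ‖F (e v)‖ + ‖F (e v) - F v‖ := by
      have := norm_sub_norm_le (F v) (F (e v))
      rw [norm_sub_rev] at this
      linarith
    set a := ‖F v‖
    set b := ‖F (e v)‖
    set d := ‖F (e v) - F v‖
    have ha : 0 ≤ a := norm_nonneg _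
    have hb : 0 ≤ b := norm_nonneg _
    have hd : 0 ≤ d := norm_nonneg _
    have hrhs : 0 ≤ d ^ 2 / ε + ε / 2 * (a ^ 2 + b ^ 2) := by positivity
    have key : d * (a + b) ≤ d ^ 2 / ε + ε / 2 * (a ^ 2 + b ^ 2) := by
      have h2 : d ^ 2 / ε + ε / 2 * (a ^ 2 + b ^ 2) - d * (a + b) =
          ((d - ε * a) ^ 2 + (d - ε * b) ^ 2) / (2 * ε) := by
        field_simp
        ring
      have h3 : 0 ≤ ((d - ε * a) ^ 2 + (d - ε * b) ^ 2) / (2 * ε) := by positivity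
      linarith
    have hle : a ^ 2 - b ^ 2 ≤ d ^ 2 / ε + ε / 2 * (a ^ 2 + b ^ 2) := by
      nlinarith
    calc (a ^ 2 - b ^ 2) * h (e v)
        ≤ (d ^ 2 / ε + ε / 2 * (a ^ 2 + b ^ 2)) * h (e v) :=
          mul_le_mul_of_nonneg_right hle (h0 _)
      _ ≤ _ := mul_le_of_le_one_right hrhs (h1 _)
  rw [hshift]
  refine (Finset.sum_le_sum fun v _ => hpt v).trans ?_
  have h2 := hinv fun v => ‖F v‖ ^ 2
  rw [Finset.sum_add_distrib, ← Finset.sum_div, ← Finset.mul_sum, Finset.sum_add_distrib, h2]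
  have h3 : (∑ v, ‖F (e v) - F v‖ ^ 2) / ε ≤ ε * ∑ v, ‖F v‖ ^ 2 := by
    rw [div_le_iff₀ hε]
    linarith
  linarith

theorem sum_norm_sq_symm_sub {V : Type*} [Fintype V] (F : V → ℂ) (e : V ≃ V) :
    ∑ v, ‖F (e.symm v) - F v‖ ^ 2 = ∑ v, ‖F (e v) - F v‖ ^ 2 := by
  rw [← e.sum_comp]
  simp [norm_sub_rev]

/-! ### Sectors of the plane -/

/-- The indicator of a set of integer points, pulled back to `(ℤ/m)²` along minimal
representatives. -/
noncomputable def sectorIndicator {m : ℕ} (P : ℤ → ℤ → Prop) (z : ZMod m × ZMod m) : ℝ :=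
  open scoped Classical in if P z.1.valMinAbs z.2.valMinAbs then 1 else 0

theorem sectorIndicator_nonneg {m : ℕ} (P : ℤ → ℤ → Prop) (z : ZMod m × ZMod m) :
    0 ≤ sectorIndicator P z := by
  unfold sectorIndicator; split_ifs <;> norm_num

theorem sectorIndicator_le_one {m : ℕ} (P : ℤ → ℤ → Prop) (z : ZMod m × ZMod m) :
    sectorIndicator P z ≤ 1 := by
  unfold sectorIndicator; split_ifs <;> norm_num

theorem sectorIndicator_sub_nonneg {m : ℕ} {P : ℤ → ℤ → Prop} {z w : ZMod m × ZMod m}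
    (h : P z.1.valMinAbs z.2.valMinAbs → P w.1.valMinAbs w.2.valMinAbs) :
    0 ≤ sectorIndicator P w - sectorIndicator P z := by
  unfold sectorIndicator; split_ifs <;> simp_all

theorem sectorIndicator_sub_eq_one {m : ℕ} {P : ℤ → ℤ → Prop} {z w : ZMod m × ZMod m}
    (hz : ¬ P z.1.valMinAbs z.2.valMinAbs) (hw : P w.1.valMinAbs w.2.valMinAbs) :
    sectorIndicator P w - sectorIndicator P z = 1 := by
  simp [sectorIndicator, hz, hw]

theorem neg_one_le_sectorIndicator_sub {m : ℕ} (P : ℤ → ℤ → Prop) (z w : ZMod m × ZMod m) :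
    -1 ≤ sectorIndicator P w - sectorIndicator P z := by
  linarith [sectorIndicator_nonneg P w, sectorIndicator_le_one P z]

/-- The points of slope in `[1, ∞]`. -/
def SteepPos (i j : ℤ) : Prop := (0 ≤ i ∧ i ≤ j ∧ 0 < j) ∨ (i ≤ 0 ∧ j ≤ i ∧ j < 0)

/-- The points of slope in `(1, ∞]`. -/
def SteepPosStrict (i j : ℤ) : Prop := (0 ≤ i ∧ i < j) ∨ (i ≤ 0 ∧ j < i)

/-- The points of slope in `[0, 1]`. -/
def FlatPos (i j : ℤ) : Prop := (0 ≤ j ∧ j ≤ i ∧ 0 < i) ∨ (j ≤ 0 ∧ i ≤ j ∧ i < 0)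

/-- The points of slope in `(-∞, -1)`. -/
def SteepNeg (i j : ℤ) : Prop := (0 < i ∧ j < -i) ∨ (i < 0 ∧ -i < j)

/-- The points of slope in `(-1, 0)`. -/
def FlatNeg (i j : ℤ) : Prop := (0 < j ∧ i < -j) ∨ (j < 0 ∧ -j < i)

/-- The total growth of the five sector indicators under shears at a point. -/
noncomputable def sectorGrowth {m : ℕ} (z : ZMod m × ZMod m) : ℝ :=
  (sectorIndicator SteepPos (shearRight m z) - sectorIndicator SteepPos z) +
  (sectorIndicator SteepPosStrict (shearRight m z) - sectorIndicator SteepPosStrict z) +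
  (sectorIndicator FlatPos (shearLeft m z) - sectorIndicator FlatPos z) +
  (sectorIndicator SteepNeg ((shearRight m).symm z) - sectorIndicator SteepNeg z) +
  (sectorIndicator FlatNeg ((shearLeft m).symm z) - sectorIndicator FlatNeg z)

theorem neg_five_le_sectorGrowth {m : ℕ} (z : ZMod m × ZMod m) : -5 ≤ sectorGrowth z := by
  unfold sectorGrowth
  linarith [neg_one_le_sectorIndicator_sub SteepPos z (shearRight m z),
    neg_one_le_sectorIndicator_sub SteepPosStrict z (shearRight m z),
    neg_one_le_sectorIndicator_sub FlatPos z (shearLeft m z),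
    neg_one_le_sectorIndicator_sub SteepNeg z ((shearRight m).symm z),
    neg_one_le_sectorIndicator_sub FlatNeg z ((shearLeft m).symm z)]

theorem valMinAbs_add_of_small {m : ℕ} [NeZero m] {p q : ZMod m} (hp : 4 * |p.valMinAbs| < m)
    (hq : 4 * |q.valMinAbs| < m) : (p + q).valMinAbs = p.valMinAbs + q.valMinAbs := by
  rw [ZMod.valMinAbs_spec]
  refine ⟨by simp, ?_⟩
  rw [Set.mem_Ioc]
  rcases abs_cases p.valMinAbs with h | h <;> rcases abs_cases q.valMinAbs with h' | h' <;> omega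

theorem valMinAbs_sub_of_small {m : ℕ} [NeZero m] {p q : ZMod m} (hp : 4 * |p.valMinAbs| < m)
    (hq : 4 * |q.valMinAbs| < m) : (p - q).valMinAbs = p.valMinAbs - q.valMinAbs := by
  rw [ZMod.valMinAbs_spec]
  refine ⟨by simp, ?_⟩
  rw [Set.mem_Ioc]
  rcases abs_cases p.valMinAbs with h | h <;> rcases abs_cases q.valMinAbs with h' | h' <;> omega

theorem one_le_sectorGrowth {m : ℕ} [NeZero m] {z : ZMod m × ZMod m} (hz : z ≠ 0)
    (h1 : 4 * |z.1.valMinAbs| < m) (h2 : 4 * |z.2.valMinAbs| < m) : 1 ≤ sectorGrowth z := by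
  have hadd := valMinAbs_add_of_small h1 h2
  have hsub := valMinAbs_sub_of_small h1 h2
  have hsub' := valMinAbs_sub_of_small h2 h1
  have hne : z.1.valMinAbs ≠ 0 ∨ z.2.valMinAbs ≠ 0 := by
    by_contra hcon
    push Not at hcon
    simp only [ZMod.valMinAbs_eq_zero] at hcon
    exact hz (Prod.ext hcon.1 hcon.2)
  have a1 : SteepPos z.1.valMinAbs z.2.valMinAbs →
      SteepPos (shearRight m z).1.valMinAbs (shearRight m z).2.valMinAbs := by
    simp only [shearRight, Equiv.coe_fn_mk, hadd, SteepPos]; omega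
  have a2 : SteepPosStrict z.1.valMinAbs z.2.valMinAbs →
      SteepPosStrict (shearRight m z).1.valMinAbs (shearRight m z).2.valMinAbs := by
    simp only [shearRight, Equiv.coe_fn_mk, hadd, SteepPosStrict]; omega
  have a3 : FlatPos z.1.valMinAbs z.2.valMinAbs →
      FlatPos (shearLeft m z).1.valMinAbs (shearLeft m z).2.valMinAbs := by
    simp only [shearLeft, Equiv.coe_fn_mk, hadd, FlatPos]; omega
  have a4 : SteepNeg z.1.valMinAbs z.2.valMinAbs →
      SteepNeg ((shearRight m).symm z).1.valMinAbs ((shearRight m).symm z).2.valMinAbs := by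
    simp only [shearRight, Equiv.coe_fn_symm_mk, hsub', SteepNeg]; omega
  have a5 : FlatNeg z.1.valMinAbs z.2.valMinAbs →
      FlatNeg ((shearLeft m).symm z).1.valMinAbs ((shearLeft m).symm z).2.valMinAbs := by
    simp only [shearLeft, Equiv.coe_fn_symm_mk, hsub, FlatNeg]; omega
  -- By slope: `[0, 1)` enters `SteepPos`, `1` enters `SteepPosStrict`, `(1, ∞]` enters `FlatPos`,
  -- `[-1, 0)` enters `SteepNeg` and `(-∞, -1)` enters `FlatNeg`. The strict variant is needed for
  -- the diagonal, which already lies in both `SteepPos` and `FlatPos`.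
  have hgain :
      (¬ SteepPos z.1.valMinAbs z.2.valMinAbs ∧
        SteepPos (shearRight m z).1.valMinAbs (shearRight m z).2.valMinAbs) ∨
      (¬ SteepPosStrict z.1.valMinAbs z.2.valMinAbs ∧
        SteepPosStrict (shearRight m z).1.valMinAbs (shearRight m z).2.valMinAbs) ∨
      (¬ FlatPos z.1.valMinAbs z.2.valMinAbs ∧
        FlatPos (shearLeft m z).1.valMinAbs (shearLeft m z).2.valMinAbs) ∨
      (¬ SteepNeg z.1.valMinAbs z.2.valMinAbs ∧
        SteepNeg ((shearRight m).symm z).1.valMinAbs ((shearRight m).symm z).2.valMinAbs) ∨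
      (¬ FlatNeg z.1.valMinAbs z.2.valMinAbs ∧
        FlatNeg ((shearLeft m).symm z).1.valMinAbs ((shearLeft m).symm z).2.valMinAbs) := by
    simp only [shearRight, shearLeft, Equiv.coe_fn_mk, Equiv.coe_fn_symm_mk, hadd, hsub, hsub',
      SteepPos, SteepPosStrict, FlatPos, SteepNeg, FlatNeg]
    clear a1 a2 a3 a4 a5 hadd hsub hsub' h1 h2
    generalize z.1.valMinAbs = i at *
    generalize z.2.valMinAbs = j at *
    rcases lt_trichotomy i 0 with hi | hi | hi <;> rcases lt_trichotomy j 0 with hj | hj | hj <;>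
      rcases lt_trichotomy i j with hij | hij | hij <;>
      rcases lt_trichotomy i (-j) with hij' | hij' | hij' <;> omega
  have b1 := sectorIndicator_sub_nonneg a1
  have b2 := sectorIndicator_sub_nonneg a2
  have b3 := sectorIndicator_sub_nonneg a3
  have b4 := sectorIndicator_sub_nonneg a4
  have b5 := sectorIndicator_sub_nonneg a5
  unfold sectorGrowth
  rcases hgain with ⟨h, h'⟩ | ⟨h, h'⟩ | ⟨h, h'⟩ | ⟨h, h'⟩ | ⟨h, h'⟩ <;>
    linarith [sectorIndicator_sub_eq_one h h']

/-! ### Spectral gap -/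

/-- Translation multiplies the transform by a character value, which is at distance at least 1 from
1 at the far frequencies; Parseval does the rest. -/
theorem sum_far_le {m : ℕ} [NeZero m] (f : ZMod m × ZMod m → ℂ) (a : ZMod m × ZMod m)
    (π : ZMod m × ZMod m → ZMod m) (hπ : ∀ z : ZMod m × ZMod m, z.1 * a.1 + z.2 * a.2 = π z) :
    ∑ z, ‖torusFourier f z‖ ^ 2 * (if (m : ℤ) ≤ 4 * |(π z).valMinAbs| then 1 else 0) ≤
      (m : ℝ) ^ 2 * ∑ w, ‖f (w + a) - f w‖ ^ 2 := by
  rw [← torusFourier_parseval fun w => f (w + a) - f w]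
  refine Finset.sum_le_sum fun z _ => ?_
  rw [torusFourier_sub, torusFourier_comp_add, hπ, ← sub_one_mul, norm_mul, mul_pow]
  split_ifs with h
  · rw [mul_comm]
    refine mul_le_mul_of_nonneg_right ?_ (by positivity)
    exact one_le_pow₀ (one_le_norm_stdAddChar_neg_sub_one h)
  · rw [mul_zero]
    positivity

theorem spectral_gap {m : ℕ} [NeZero m] (f : ZMod m × ZMod m → ℂ) (hf : ∑ w, f w = 0)
    (h₁ : ∑ w, ‖f (w + (1, 0)) - f w‖ ^ 2 ≤ (1 / 20) ^ 2 * ∑ w, ‖f w‖ ^ 2)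
    (h₂ : ∑ w, ‖f (w + (0, 1)) - f w‖ ^ 2 ≤ (1 / 20) ^ 2 * ∑ w, ‖f w‖ ^ 2)
    (h₃ : ∑ w, ‖f (shearLeft m w) - f w‖ ^ 2 ≤ (1 / 20) ^ 2 * ∑ w, ‖f w‖ ^ 2)
    (h₄ : ∑ w, ‖f (shearRight m w) - f w‖ ^ 2 ≤ (1 / 20) ^ 2 * ∑ w, ‖f w‖ ^ 2) :
    ∑ w, ‖f w‖ ^ 2 = 0 := by
  have hm : (0 : ℝ) < (m : ℝ) ^ 2 := by
    have : (0 : ℝ) < m := by exact_mod_cast NeZero.pos m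
    positivity
  set F := torusFourier f with hF
  have hpars : ∑ z, ‖F z‖ ^ 2 = (m : ℝ) ^ 2 * ∑ w, ‖f w‖ ^ 2 := torusFourier_parseval f
  have hF0 : F 0 = 0 := by simp [hF, torusFourier, hf]
  have scale : ∀ {D : ℝ}, D ≤ (1 / 20) ^ 2 * ∑ w, ‖f w‖ ^ 2 →
      (m : ℝ) ^ 2 * D ≤ (1 / 20) ^ 2 * ∑ z, ‖F z‖ ^ 2 := by
    intro D hD
    rw [hpars]
    linarith [mul_le_mul_of_nonneg_left hD hm.le]
  have far₁ := (sum_far_le f (1, 0) (fun z => z.1) (by simp)).trans (scale h₁)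
  have far₂ := (sum_far_le f (0, 1) (fun z => z.2) (by simp)).trans (scale h₂)
  have invR' : ∑ z, ‖F ((shearRight m).symm z) - F z‖ ^ 2 ≤ (1 / 20) ^ 2 * ∑ z, ‖F z‖ ^ 2 := by
    refine le_trans (le_of_eq ?_) (scale h₃)
    rw [← torusFourier_parseval fun w => f (shearLeft m w) - f w]
    simp_rw [torusFourier_sub, torusFourier_comp_shearLeft, hF]
  have invL' : ∑ z, ‖F ((shearLeft m).symm z) - F z‖ ^ 2 ≤ (1 / 20) ^ 2 * ∑ z, ‖F z‖ ^ 2 := by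
    refine le_trans (le_of_eq ?_) (scale h₄)
    rw [← torusFourier_parseval fun w => f (shearRight m w) - f w]
    simp_rw [torusFourier_sub, torusFourier_comp_shearRight, hF]
  have invR := (sum_norm_sq_symm_sub F (shearRight m)).symm.trans_le invR'
  have invL := (sum_norm_sq_symm_sub F (shearLeft m)).symm.trans_le invL'
  have bound : ∀ (P : ℤ → ℤ → Prop) (e : ZMod m × ZMod m ≃ ZMod m × ZMod m),
      ∑ z, ‖F (e z) - F z‖ ^ 2 ≤ (1 / 20) ^ 2 * ∑ z, ‖F z‖ ^ 2 →
      ∑ z, ‖F z‖ ^ 2 * (sectorIndicator P (e z) - sectorIndicator P z) ≤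
        2 * (1 / 20) * ∑ z, ‖F z‖ ^ 2 := fun P e he =>
    sum_norm_sq_mul_le_of_almost_invariant F e _ (sectorIndicator_nonneg P)
      (sectorIndicator_le_one P) (by norm_num) he
  have upper : ∑ z, ‖F z‖ ^ 2 * sectorGrowth z ≤ 5 * (2 * (1 / 20) * ∑ z, ‖F z‖ ^ 2) := by
    simp only [sectorGrowth, mul_add, Finset.sum_add_distrib]
    linarith [bound SteepPos _ invR, bound SteepPosStrict _ invR, bound FlatPos _ invL,
      bound SteepNeg _ invR', bound FlatNeg _ invL']
  -- At far frequencies wraparound may make the growth as low as `-5`; the weight 6 restores a total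
  -- of at least 1.
  have lower : ∑ z, ‖F z‖ ^ 2 ≤ ∑ z, (‖F z‖ ^ 2 * sectorGrowth z +
      6 * (‖F z‖ ^ 2 * (if (m : ℤ) ≤ 4 * |z.1.valMinAbs| then 1 else 0)) +
      6 * (‖F z‖ ^ 2 * (if (m : ℤ) ≤ 4 * |z.2.valMinAbs| then 1 else 0))) := by
    refine Finset.sum_le_sum fun z _ => ?_
    rcases eq_or_ne z 0 with rfl | hz
    · simp [hF0]
    have hpos : 0 ≤ ‖F z‖ ^ 2 := by positivity
    have h5 := neg_five_le_sectorGrowth z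
    split_ifs with ha hb hb
    · nlinarith
    · nlinarith
    · nlinarith
    · nlinarith [one_le_sectorGrowth hz (not_le.1 ha) (not_le.1 hb)]
  rw [Finset.sum_add_distrib, Finset.sum_add_distrib, ← Finset.mul_sum, ← Finset.mul_sum] at lower
  -- The growth term contributes at most `1/2` of the mass and the far terms `12/400`, together less
  -- than 1.
  have hM : ∑ z, ‖F z‖ ^ 2 ≤ 0 := by linarith
  have hnn : 0 ≤ ∑ w, ‖f w‖ ^ 2 := by positivity
  nlinarith

/-! ### Margulis graphs -/

/-- A summand is 1 exactly when one of `v`, `e v` is in `A` and the other is not, and the outside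
one is then in `∂A`. As `e` is a bijection, each boundary vertex is charged at most twice. -/
theorem sum_indicator_shift_le {V : Type*} [Fintype V] (G : SimpleGraph V) (e : V ≃ V)
    (he : ∀ v, v ≠ e v → G.Adj v (e v)) (A : Set V) (f : V → ℂ) (c : ℂ)
    (hf : ∀ v, f v = A.indicator 1 v - c) :
    ∑ v, ‖f (e v) - f v‖ ^ 2 ≤ 2 * ((vertexBoundary G A).ncard : ℝ) := by
  classical
  have hB : ((vertexBoundary G A).ncard : ℝ) = ∑ v, if v ∈ vertexBoundary G A then 1 else 0 := by
    rw [Set.ncard_eq_toFinset_card', Finset.sum_boole]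
    congr 2
    ext v
    simp
  have hB' : ((vertexBoundary G A).ncard : ℝ) =
      ∑ v, if e v ∈ vertexBoundary G A then 1 else 0 := by
    rw [hB]
    exact (e.sum_comp fun v => if v ∈ vertexBoundary G A then (1 : ℝ) else 0).symm
  rw [two_mul]
  nth_rw 1 [hB]
  rw [hB', ← Finset.sum_add_distrib]
  refine Finset.sum_le_sum fun v _ => ?_
  have hnn : ∀ p : Prop, ∀ [Decidable p], (0 : ℝ) ≤ if p then 1 else 0 := by
    intro p _; split_ifs <;> norm_num
  rw [hf, hf, sub_sub_sub_cancel_right]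
  by_cases h1 : v ∈ A <;> by_cases h2 : e v ∈ A
  · simp only [Set.indicator_of_mem h1, Set.indicator_of_mem h2, Pi.one_apply, sub_self, norm_zero]
    have := hnn (v ∈ vertexBoundary G A)
    have := hnn (e v ∈ vertexBoundary G A)
    norm_num
    linarith
  · have hb : e v ∈ vertexBoundary G A := (mem_vertexBoundary_iff _ _ _).2
      ⟨h2, v, h1, (he v fun h => h2 (h ▸ h1)).symm⟩
    simp only [Set.indicator_of_mem h1, Set.indicator_of_notMem h2, Pi.one_apply, if_pos hb]
    have := hnn (v ∈ vertexBoundary G A)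
    norm_num
    linarith
  · have hb : v ∈ vertexBoundary G A := (mem_vertexBoundary_iff _ _ _).2
      ⟨h1, e v, h2, he v fun h => h1 (h ▸ h2)⟩
    simp only [Set.indicator_of_notMem h1, Set.indicator_of_mem h2, Pi.one_apply, if_pos hb]
    have := hnn (e v ∈ vertexBoundary G A)
    norm_num
    linarith
  · simp only [Set.indicator_of_notMem h1, Set.indicator_of_notMem h2, sub_self, norm_zero]
    have := hnn (v ∈ vertexBoundary G A)
    have := hnn (e v ∈ vertexBoundary G A)
    norm_num
    linarith

/-- The four generating permutations of the Margulis graph. -/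
def margulisGenerator (m : ℕ) : Fin 4 → (ZMod m × ZMod m ≃ ZMod m × ZMod m) :=
  ![Equiv.addRight (1, 0), Equiv.addRight (0, 1), shearLeft m, shearRight m]

/-- The Margulis graph on `(ℤ/m)²`. -/
def margulisGraph (m : ℕ) : SimpleGraph (ZMod m × ZMod m) :=
  SimpleGraph.fromRel fun v w => ∃ k, w = margulisGenerator m k v

theorem margulisGraph_adj_generator {m : ℕ} (k : Fin 4) (v : ZMod m × ZMod m)
    (h : v ≠ margulisGenerator m k v) : (margulisGraph m).Adj v (margulisGenerator m k v) :=
  (SimpleGraph.fromRel_adj _ _ _).2 ⟨h, Or.inl ⟨k, rfl⟩⟩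

theorem margulisGraph_neighborSet_ncard_le (m : ℕ) (v : ZMod m × ZMod m) :
    ((margulisGraph m).neighborSet v).ncard ≤ 8 := by
  have hsub : (margulisGraph m).neighborSet v ⊆
      Set.range (fun k => margulisGenerator m k v) ∪
        Set.range (fun k => (margulisGenerator m k).symm v) := by
    intro w hw
    have hadj : (margulisGraph m).Adj v w := hw
    rcases ((SimpleGraph.fromRel_adj _ _ _).1 hadj).2 with ⟨k, hk⟩ | ⟨k, hk⟩
    · exact Or.inl ⟨k, hk.symm⟩
    · exact Or.inr ⟨k, by simp [hk]⟩
  have hcard : ∀ g : Fin 4 → ZMod m × ZMod m, (Set.range g).ncard ≤ 4 := by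
    intro g
    rw [← Set.image_univ]
    exact (Set.ncard_image_le).trans (by simp)
  refine (Set.ncard_le_ncard hsub (Set.toFinite _)).trans ((Set.ncard_union_le _ _).trans ?_)
  have := hcard fun k => margulisGenerator m k v
  have := hcard fun k => (margulisGenerator m k).symm v
  omega

/-- The spectral gap is applied to `1_A - c` with `c` the density of `A`, of squared norm `|A|(1 -
c) ≥ |A|/2`. Since each generator moves it by at most `2|∂A|`, the constant is `1600 = 2 · 2 · 20²`.
-/
theorem margulisGraph_ncard_le {m : ℕ} [NeZero m] (A : Set (ZMod m × ZMod m))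
    (hA : 2 * A.ncard ≤ m ^ 2) :
    A.ncard ≤ 1600 * (vertexBoundary (margulisGraph m) A).ncard := by
  classical
  by_contra! hcon
  have hcon' : 1600 * ((vertexBoundary (margulisGraph m) A).ncard : ℝ) < A.ncard := by
    exact_mod_cast hcon
  have hm : (0 : ℝ) < m := by exact_mod_cast NeZero.pos m
  have hA' : 2 * (A.ncard : ℝ) ≤ (m : ℝ) ^ 2 := by exact_mod_cast hA
  set c : ℝ := A.ncard / (m : ℝ) ^ 2 with hc
  have hc0 : 0 ≤ c := by positivity
  have hc2 : c ≤ 1 / 2 := by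
    rw [hc, div_le_iff₀ (by positivity)]
    linarith
  have hcm : c * (m : ℝ) ^ 2 = A.ncard := by
    rw [hc]; field_simp
  have hsumA : ∀ t : ℝ, ∑ v, (if v ∈ A then t else 0) = A.ncard * t := by
    intro t
    rw [← Finset.sum_filter, Finset.sum_const, nsmul_eq_mul, Set.ncard_eq_toFinset_card']
    congr 3
    ext v
    simp
  have hcard : (Fintype.card (ZMod m × ZMod m) : ℝ) = (m : ℝ) ^ 2 := by
    simp [ZMod.card, sq]
  let f : ZMod m × ZMod m → ℂ := fun v => A.indicator 1 v - (c : ℂ)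
  have hfv : ∀ v, f v = (((if v ∈ A then 1 else 0) - c : ℝ) : ℂ) := by
    intro v
    simp only [f, Set.indicator_apply, Pi.one_apply]
    split_ifs <;> simp
  have hsum : ∑ v, f v = 0 := by
    simp_rw [hfv]
    rw [← Complex.ofReal_sum, Finset.sum_sub_distrib, hsumA, Finset.sum_const, Finset.card_univ,
      nsmul_eq_mul, hcard]
    rw [mul_comm _ c, hcm]
    simp
  have hnorm : ∑ v, ‖f v‖ ^ 2 = A.ncard * (1 - c) := by
    have h1 : ∀ v, ‖f v‖ ^ 2 = (if v ∈ A then 1 - 2 * c else 0) + c ^ 2 := by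
      intro v
      rw [hfv, Complex.norm_real, Real.norm_eq_abs, sq_abs]
      split_ifs <;> ring
    simp_rw [h1]
    rw [Finset.sum_add_distrib, hsumA, Finset.sum_const, Finset.card_univ, nsmul_eq_mul, hcard]
    linear_combination c * hcm
  have hApos : (0 : ℝ) < A.ncard := lt_of_le_of_lt (by positivity) hcon'
  have hgen : ∀ k, ∑ w, ‖f (margulisGenerator m k w) - f w‖ ^ 2 ≤
      (1 / 20) ^ 2 * ∑ w, ‖f w‖ ^ 2 := by
    intro k
    refine (sum_indicator_shift_le (margulisGraph m) (margulisGenerator m k)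
      (margulisGraph_adj_generator k) A f c fun v => rfl).trans ?_
    rw [hnorm]
    nlinarith
  have hzero := spectral_gap f hsum (hgen 0) (hgen 1) (hgen 2) (hgen 3)
  rw [hnorm] at hzero
  nlinarith

theorem margulisGraph_connected (m : ℕ) [NeZero m] : (margulisGraph m).Connected := by
  have hstep : ∀ k v, (margulisGraph m).Reachable v (margulisGenerator m k v) := by
    intro k v
    by_cases h : v = margulisGenerator m k v
    · rw [← h]
    · exact (margulisGraph_adj_generator k v h).reachable
  have hx : ∀ (n : ℕ) v, (margulisGraph m).Reachable v (v + ((n : ZMod m), 0)) := by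
    intro n
    induction n with
    | zero => intro v; rw [Nat.cast_zero, Prod.mk_zero_zero, add_zero]
    | succ n ih =>
      intro v
      refine (ih v).trans ?_
      convert hstep 0 (v + ((n : ZMod m), 0)) using 1
      simp [margulisGenerator, add_assoc]
  have hy : ∀ (n : ℕ) v, (margulisGraph m).Reachable v (v + (0, (n : ZMod m))) := by
    intro n
    induction n with
    | zero => intro v; rw [Nat.cast_zero, Prod.mk_zero_zero, add_zero]
    | succ n ih =>
      intro v
      refine (ih v).trans ?_
      convert hstep 1 (v + (0, (n : ZMod m))) using 1
      simp [margulisGenerator, add_assoc]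
  have h0 : ∀ v : ZMod m × ZMod m, (margulisGraph m).Reachable 0 v := by
    intro v
    have := (hx v.1.val 0).trans (hy v.2.val _)
    simpa using this
  exact ⟨fun v w => (h0 v).symm.trans (h0 w)⟩

/-- The Margulis graph as a finite connected graph. -/
def margulisFiniteGraph (m : ℕ) [NeZero m] : FiniteGraph where
  Vert := ZMod m × ZMod m
  finite := inferInstance
  graph := margulisGraph m
  connected := margulisGraph_connected m

theorem card_margulisFiniteGraph (m : ℕ) [NeZero m] :
    Nat.card (margulisFiniteGraph m).Vert = m ^ 2 := by
  change Nat.card (ZMod m × ZMod m) = m ^ 2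
  simp [sq]

theorem margulisFiniteGraph_cheeger_ge (m : ℕ) [NeZero m] :
    (1600 : ℝ≥0∞)⁻¹ ≤ (margulisFiniteGraph m).cheeger := by
  refine le_iInf₂ fun A hA => ?_
  have h2 : 2 * A.ncard ≤ m ^ 2 := by
    have := hA.2
    rw [card_margulisFiniteGraph, ENNReal.le_div_iff_mul_le (by simp) (by simp)] at this
    rw [mul_comm]
    exact_mod_cast this
  have h := margulisGraph_ncard_le (m := m) A h2
  rw [ENNReal.le_div_iff_mul_le (Or.inl (by exact_mod_cast hA.1.ne')) (Or.inl (by simp)),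
    ENNReal.inv_mul_le_iff (by simp) (by simp)]
  exact_mod_cast h

/-! ### Measures with a light separating boundary -/

theorem ncard_vertexBoundary_le {V : Type*} [Finite V] (G : SimpleGraph V) {K : ℕ}
    (hK : ∀ v, (G.neighborSet v).ncard ≤ K) (A : Set V) :
    (vertexBoundary G A).ncard ≤ K * A.ncard := by
  have hsub : vertexBoundary G A ⊆ ⋃ a ∈ A.toFinite.toFinset, G.neighborSet a := by
    intro v hv
    obtain ⟨-, a, ha, hadj⟩ := (mem_vertexBoundary_iff _ _ _).1 hv
    simp only [Set.mem_iUnion]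
    exact ⟨a, by simpa using ha, hadj.symm⟩
  refine (Set.ncard_le_ncard hsub (Set.toFinite _)).trans ?_
  refine (Finset.set_ncard_biUnion_le _ _).trans ?_
  refine (Finset.sum_le_sum fun a _ => hK a).trans ?_
  rw [Finset.sum_const, smul_eq_mul, mul_comm, Set.ncard_eq_toFinset_card A]

/-- The measure on all subsets of a finite type with prescribed point masses. -/
noncomputable def pointMassMeasure {V : Type*} [Fintype V] (w : V → ℝ≥0∞) : @Measure V ⊤ :=
  letI : MeasurableSpace V := ⊤
  ∑ v, w v • Measure.dirac v

theorem pointMassMeasure_apply {V : Type*} [Fintype V] (w : V → ℝ≥0∞) (B : Set V) :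
    pointMassMeasure w B = ∑ v, B.indicator w v := by
  let _ : MeasurableSpace V := ⊤
  simp only [pointMassMeasure, Measure.coe_finsetSum, Finset.sum_apply, Measure.smul_apply,
    smul_eq_mul]
  refine Finset.sum_congr rfl fun v _ => ?_
  rw [Measure.dirac_apply' v (MeasurableSpace.measurableSet_top)]
  by_cases h : v ∈ B <;> simp [h]

theorem pointMassMeasure_of_const {V : Type*} [Fintype V] (w : V → ℝ≥0∞) (B : Set V) (c : ℝ≥0∞)
    (h : ∀ v ∈ B, w v = c) : pointMassMeasure w B = B.ncard * c := by
  classical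
  rw [pointMassMeasure_apply]
  have h1 : ∀ v, B.indicator w v = if v ∈ B then c else 0 := by
    intro v
    by_cases hv : v ∈ B <;> simp [hv, h]
  simp_rw [h1]
  rw [← Finset.sum_filter, Finset.sum_const, nsmul_eq_mul, Set.ncard_eq_toFinset_card']
  congr 3
  ext v
  simp

theorem exists_measure_of_valency_le (X : FiniteGraph) {K n : ℕ} (hn : n ≠ 0)
    (hK : ∀ v, (X.graph.neighborSet v).ncard ≤ K) (hcard : (K + 2) * n ≤ Nat.card X.Vert) :
    ∃ Y : FiniteMeasuredGraph, Y.toFiniteGraph = X ∧ Y.HasFullSupport ∧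
      ⨆ v, Y.measure {v} / Y.measure Set.univ ≤ (n : ℝ≥0∞)⁻¹ ∧
      Y.measuredCheeger ≤ K * (n : ℝ≥0∞)⁻¹ := by
  classical
  have := X.finite
  let _ : Fintype X.Vert := Fintype.ofFinite _
  have hn0 : (n : ℝ≥0∞) ≠ 0 := by exact_mod_cast hn
  have hnt : (n : ℝ≥0∞) ≠ ∞ := ENNReal.natCast_ne_top n
  have hninv : (n : ℝ≥0∞)⁻¹ ≤ 1 := by
    rw [ENNReal.inv_le_one]
    exact_mod_cast Nat.one_le_iff_ne_zero.2 hn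
  obtain ⟨A, -, hA⟩ := Set.exists_subset_card_eq (s := (Set.univ : Set X.Vert)) (n := n) (by
    rw [Set.ncard_univ]
    nlinarith)
  set B := vertexBoundary X.graph A with hBdef
  have hB : B.ncard ≤ K * n := hA ▸ ncard_vertexBoundary_le X.graph hK A
  let w : X.Vert → ℝ≥0∞ := fun v => if v ∈ B then (n : ℝ≥0∞)⁻¹ else 1
  have hw1 : ∀ v, w v ≤ 1 := by
    intro v
    simp only [w]
    split_ifs
    · exact hninv
    · exact le_rfl
  have hw0 : ∀ v, w v ≠ 0 := by
    intro v
    simp only [w]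
    split_ifs
    · simp
    · simp
  have hsingle : ∀ v, pointMassMeasure w {v} = w v := by
    intro v
    rw [pointMassMeasure_of_const w {v} (w v) (by simp)]
    simp
  have hmA : pointMassMeasure w A = n := by
    rw [pointMassMeasure_of_const w A 1, hA, mul_one]
    intro v hv
    have : v ∉ B := fun h => ((mem_vertexBoundary_iff _ _ _).1 h).1 hv
    simp [w, this]
  have hmB : pointMassMeasure w B ≤ K := by
    rw [pointMassMeasure_of_const w B (n : ℝ≥0∞)⁻¹ (fun v hv => by simp [w, hv]),
      ← div_eq_mul_inv, ENNReal.div_le_iff hn0 hnt]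
    exact_mod_cast hB
  have huniv : (2 * n : ℝ≥0∞) ≤ pointMassMeasure w Set.univ := by
    have h1 : pointMassMeasure w Bᶜ = (Bᶜ.ncard : ℝ≥0∞) := by
      rw [pointMassMeasure_of_const w Bᶜ 1, mul_one]
      intro v hv
      have : v ∉ B := hv
      simp [w, this]
    refine le_trans ?_ (measure_mono (Set.subset_univ Bᶜ))
    rw [h1]
    have h2 := Set.ncard_add_ncard_compl B
    -- This is where `K + 2` is used: at most `K * n` vertices lie in `B`, leaving `2 * n` of mass
    -- 1, so that `A` has at most half the total mass.
    have h3 : 2 * n ≤ Bᶜ.ncard := by nlinarith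
    exact_mod_cast h3
  have htop : pointMassMeasure w Set.univ < ∞ := by
    rw [pointMassMeasure_apply, ENNReal.sum_lt_top]
    intro v _
    simpa using (hw1 v).trans_lt ENNReal.one_lt_top
  have hn_le : (n : ℝ≥0∞) ≤ pointMassMeasure w Set.univ := by
    refine le_trans ?_ huniv
    rw [two_mul]
    exact le_self_add
  refine ⟨⟨X, pointMassMeasure w, htop, ?_⟩, rfl, ?_, ?_, ?_⟩
  · intro h
    rw [h] at hmA
    exact hn0 (by simpa using hmA.symm)
  · ext v
    simpa [FiniteMeasuredGraph.HasFullSupport, hsingle] using hw0 v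
  · refine iSup_le fun v => ?_
    change pointMassMeasure w {v} / pointMassMeasure w Set.univ ≤ _
    rw [hsingle, ← one_div]
    exact ENNReal.div_le_div (hw1 v) hn_le
  · refine (iInf₂_le A ⟨?_, ?_⟩).trans ?_
    · change pointMassMeasure w B / pointMassMeasure w A ≤ _
      rw [hmA, div_eq_mul_inv]
      gcongr
    · change 0 < pointMassMeasure w A
      rw [hmA]
      exact pos_iff_ne_zero.2 hn0
    · change pointMassMeasure w A ≤ pointMassMeasure w Set.univ / 2
      rw [hmA, ENNReal.le_div_iff_mul_le (by simp) (by simp), mul_comm]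
      exact huniv

theorem isExpanderSequence_margulis :
    IsExpanderSequence fun n => margulisFiniteGraph (10 * (n + 1)) where
  uniformly_bounded_valency := ⟨8, fun n v => margulisGraph_neighborSet_ncard_le _ v⟩
  card_tendsto := by
    simp_rw [card_margulisFiniteGraph]
    refine tendsto_atTop_mono (fun n => ?_) tendsto_id
    simp only [id]
    nlinarith
  cheeger_pos := lt_of_lt_of_le (by simp)
    (le_iInf fun n => margulisFiniteGraph_cheeger_ge (10 * (n + 1)))

theorem mainTheorem10 :
    ∃ X : ℕ → FiniteMeasuredGraph,
      IsExpanderSequence (fun n => (X n).toFiniteGraph) ∧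
      (∀ n, (X n).HasFullSupport) ∧
      IsGhostly X ∧
      ¬ IsMeasuredExpanderSequence X := by
  have hex : ∀ n : ℕ, ∃ Y : FiniteMeasuredGraph,
      Y.toFiniteGraph = margulisFiniteGraph (10 * (n + 1)) ∧ Y.HasFullSupport ∧
      ⨆ v, Y.measure {v} / Y.measure Set.univ ≤ ((n + 1 : ℕ) : ℝ≥0∞)⁻¹ ∧
      Y.measuredCheeger ≤ (8 : ℕ) * ((n + 1 : ℕ) : ℝ≥0∞)⁻¹ := fun n =>
    exists_measure_of_valency_le _ n.succ_ne_zero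
      -- The factor 10 in the modulus is `K + 2` for `K = 8`, so the size condition is `t ≤ t²` with
      -- `t = 10 * (n + 1)`.
      (fun v => margulisGraph_neighborSet_ncard_le _ v) (by
        rw [card_margulisFiniteGraph]
        nlinarith)
  choose Y hY hsupp hghost hch using hex
  have hinv : Tendsto (fun n : ℕ => ((n + 1 : ℕ) : ℝ≥0∞)⁻¹) atTop (𝓝 0) :=
    (tendsto_add_atTop_iff_nat 1).2 ENNReal.tendsto_inv_nat_nhds_zero
  refine ⟨Y, ?_, hsupp, ?_, ?_⟩
  · simp_rw [hY]
    exact isExpanderSequence_margulis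
  · exact tendsto_of_tendsto_of_tendsto_of_le_of_le tendsto_const_nhds hinv
      (fun _ => zero_le) hghost
  · intro h
    have hlim : Tendsto (fun n : ℕ => ((8 : ℕ) : ℝ≥0∞) * ((n + 1 : ℕ) : ℝ≥0∞)⁻¹) atTop (𝓝 0) := by
      simpa using ENNReal.Tendsto.const_mul hinv (Or.inr (ENNReal.natCast_ne_top 8))
    have hle : ⨅ n, (Y n).measuredCheeger ≤ 0 :=
      ge_of_tendsto' hlim fun n => (iInf_le _ n).trans (hch n)
    exact absurd h hle.not_gt
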